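/- Let $0<C<\infty$. There is a constant $K=K(C)$ with $0<K<\infty$, depending only on $C$, such that the following holds. Let $\mathbb D$ be the open unit disc of $\mathbb C$, and let $A$ be an analytic function in $\mathbb D$ with $$|A(z)|\,(1-|z|^2)^2\le 1+C\,(1-|z|),\qquad z\in\mathbb D.$$ Let $f$ be any non-trivial (not identically zero) analytic solution of $f''+Af=0$ in $\mathbb D$, and let $\{z_n\}$ be its zero-sequence in $\mathbb D$, with zeros repeated according to multiplicity. Then $$\sum_{z_n\in Q}(1-|z_n|)^{1/2}\le K\,\ell(Q)^{1/2}$$ for every Carleson square $Q$. Here a Carleson square is a set $$Q=Q(I)=\{re^{i\theta}: e^{i\theta}\in I,\ 1-|I|\le r<1\},$$ where $I\subset\partial\mathbb D$ is an arc (possibly the whole circle), $|I|\in(0,1]$ is its Euclidean arc length divided by $2\pi$, and $\ell(Q)=|I|$. -/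

import Mathlib

open scoped ENNReal

/-- `f` is an analytic solution of `f'' + A f = 0` in the open unit disc. -/
def IsDiscSolution (A f : ℂ → ℂ) : Prop :=
  AnalyticOnNhd ℂ f (Metric.ball 0 1) ∧
    ∀ z ∈ Metric.ball (0 : ℂ) 1, deriv (deriv f) z + A z * f z = 0

/-- `I` is an arc of the unit circle (open, closed or half-open; the full circle is allowed)
whose normalized length, i.e. Euclidean arc length divided by `2π`, is `l`. -/
def IsCircleArc (I : Set ℂ) (l : ℝ) : Prop :=
  ∃ (a b : ℝ) (J : Set ℝ), a < b ∧ b ≤ a + 2 * Real.pi ∧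
    Set.Ioo a b ⊆ J ∧ J ⊆ Set.Icc a b ∧
    I = (fun θ : ℝ => Complex.exp (θ * Complex.I)) '' J ∧
    l = (b - a) / (2 * Real.pi)

/-- The Carleson square `{r ζ : ζ ∈ I, 1 - l ≤ r < 1}` based on an arc `I` of normalized
length `l`. -/
def carlesonSquare (I : Set ℂ) (l : ℝ) : Set ℂ :=
  {z | ∃ (r : ℝ) (ζ : ℂ), ζ ∈ I ∧ 1 - l ≤ r ∧ r < 1 ∧ z = r * ζ}

/-- The sum of `(1 - |z|)^(1/2)` over the zeros `z` of `f` lying in `Q`, each zero being repeated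
according to its multiplicity. The value is in `[0, ∞]`. -/
noncomputable def zeroSum (f : ℂ → ℂ) (Q : Set ℂ) : ℝ≥0∞ :=
  ∑' z : {z : ℂ // z ∈ Q ∧ f z = 0},
    ((analyticOrderAt f (z : ℂ) : ℕ∞) : ℝ≥0∞) *
      ENNReal.ofReal ((1 - ‖(z : ℂ)‖) ^ (1 / 2 : ℝ))

/-! Along a hyperbolic geodesic `z = q/p` with `|dz| = (1 - |z|^2) dt`, the lift `u = p * f(z)`
solves `u'' = (1 - B) u` with `‖B‖ = ‖A‖ (1 - |z|^2)^2`. The growth bound leaves only a small excess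
over `1`, so Sturm comparison keeps zeros of `f` near the boundary far apart (`two_le_of_geodesic`).
For two zeros at height about `h`, this gives Euclidean distance at least a constant times `h^(1/3)`
(`le_cube_dist_of_zeros`). A grid count then bounds each dyadic layer of the Carleson square
(`tsum_level_le`). Since `1/3 < 1/2`, the weights `h^(1/2)` outweigh the count and the layers sum
geometrically. -/

/-! ### Sturm comparison and simplicity of zeros -/

theorem vanish_of_zeros_of_bound {u u' B : ℝ → ℂ} {L ε : ℝ} (hL : 0 < L) (hε : ε * L ^ 2 < 2)
    (hu : ∀ t, HasDerivAt u (u' t) t) (hu' : ∀ t, HasDerivAt u' ((1 - B t) * u t) t)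
    (hB : ∀ t ∈ Set.Icc 0 L, ‖B t‖ ≤ 1 + ε) (h0 : u 0 = 0) (h1 : u L = 0) :
    u (L / 2) = 0 ∧ u' (L / 2) = 0 := by
  -- Comparison function: `s'' = -2` and `0 < s ≤ L ^ 2`, hence `s'' + ε s < 0` on `[0, L]`. The
  -- Picone-type quantity `F` is then monotone and vanishes at both ends. At the midpoint `s' = 0`,
  -- so `F' = 0` there yields `u = u' = 0`.
  set s : ℝ → ℝ := fun t => L ^ 2 - (t - L / 2) ^ 2 with hs
  set F : ℝ → ℝ := fun t => inner ℝ (u t) (u' t) - (-2 * (t - L / 2) / s t) * ‖u t‖ ^ 2 with hF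
  have spos : ∀ t ∈ Set.Icc 0 L, 0 < s t := by
    intro t ht
    have : (t - L / 2) ^ 2 ≤ (L / 2) ^ 2 := by
      apply sq_le_sq'
      · linarith [ht.1]
      · linarith [ht.2]
    simp only [hs]; nlinarith
  have hinner : ∀ t ∈ Set.Icc 0 L, -ε * ‖u t‖ ^ 2 ≤ inner ℝ (u t) ((1 - B t) * u t) := by
    intro t ht
    have e1 : inner ℝ (u t) ((1 - B t) * u t) = (1 - (B t).re) * ‖u t‖ ^ 2 := by
      rw [Complex.inner, Complex.sq_norm, Complex.normSq_apply]
      simp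
      ring
    rw [e1]
    have := (Complex.re_le_norm (B t)).trans (hB t ht)
    exact mul_le_mul_of_nonneg_right (by linarith) (by positivity)
  have hd : ∀ t ∈ Set.Icc 0 L, ∃ F', HasDerivAt F F' t ∧
      ‖u' t - (-2 * (t - L / 2) / s t : ℝ) • u t‖ ^ 2 + (2 / s t - ε) * ‖u t‖ ^ 2 ≤ F' := by
    intro t ht
    have hst := (spos t ht).ne'
    have d1 : HasDerivAt (fun t : ℝ => -2 * (t - L / 2)) (-2) t := by
      simpa using ((hasDerivAt_id t).sub_const (L / 2)).const_mul (-2 : ℝ)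
    have d2 : HasDerivAt s (-2 * (t - L / 2)) t := by
      have := (((hasDerivAt_id t).sub_const (L / 2)).pow 2).const_sub (L ^ 2)
      exact this.congr_deriv (by simp)
    refine ⟨_, ((hu t).inner ℝ (hu' t)).sub ((d1.div d2 hst).mul (hu t).norm_sq), ?_⟩
    rw [norm_sub_sq_real, norm_smul, mul_pow, inner_smul_right, Real.norm_eq_abs, sq_abs,
      real_inner_self_eq_norm_sq, real_inner_comm (u t) (u' t)]
    have := hinner t ht
    have e : (-2 * s t - -2 * (t - L / 2) * (-2 * (t - L / 2))) / s t ^ 2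
        = -(2 / s t) - (-2 * (t - L / 2) / s t) ^ 2 := by
      field_simp
    rw [e, Pi.div_apply]
    nlinarith
  have hsε : ∀ t ∈ Set.Icc 0 L, 0 < 2 / s t - ε := by
    intro t ht
    have h2 := spos t ht
    have : s t ≤ L ^ 2 := by simp only [hs]; nlinarith [sq_nonneg (t - L / 2)]
    rw [sub_pos, lt_div_iff₀ h2]
    rcases le_total ε 0 with h | h <;> nlinarith
  have hmono : MonotoneOn F (Set.Icc 0 L) := by
    apply monotoneOn_of_deriv_nonneg (convex_Icc 0 L)
    · intro t ht
      obtain ⟨F', hF', -⟩ := hd t ht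
      exact hF'.continuousAt.continuousWithinAt
    · intro t ht
      obtain ⟨F', hF', -⟩ := hd t (interior_subset ht)
      exact hF'.differentiableAt.differentiableWithinAt
    · intro t ht
      have ht := interior_subset ht
      obtain ⟨F', hF', hle⟩ := hd t ht
      rw [hF'.deriv]
      have := hsε t ht
      exact le_trans (by positivity) hle
  have hz : ∀ t ∈ Set.Icc 0 L, F t = 0 := by
    intro t ht
    have a0 : F 0 = 0 := by simp [hF, h0]
    have a1 : F L = 0 := by simp [hF, h1]
    have b0 := hmono (Set.left_mem_Icc.2 hL.le) ht ht.1
    have b1 := hmono ht (Set.right_mem_Icc.2 hL.le) ht.2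
    linarith
  have hm : L / 2 ∈ Set.Icc 0 L := ⟨by linarith, by linarith⟩
  obtain ⟨F', hF', hle⟩ := hd _ hm
  have hev : F =ᶠ[nhds (L / 2)] fun _ => 0 := by
    filter_upwards [Icc_mem_nhds (show 0 < L / 2 by linarith) (show L / 2 < L by linarith)] with t ht
    exact hz t ht
  have hF0 : F' = 0 := (hF'.congr_of_eventuallyEq hev.symm).unique (hasDerivAt_const _ _)
  rw [hF0] at hle
  have h3 := hsε _ hm
  simp only [sub_self, mul_zero, zero_div, zero_smul, sub_zero] at hle
  have h4 : ‖u (L / 2)‖ ^ 2 = 0 := by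
    nlinarith [sq_nonneg ‖u' (L / 2)‖, sq_nonneg ‖u (L / 2)‖, mul_nonneg h3.le (sq_nonneg ‖u (L / 2)‖)]
  have h5 : ‖u' (L / 2)‖ ^ 2 = 0 := by
    rw [h4] at hle
    nlinarith [sq_nonneg ‖u' (L / 2)‖]
  exact ⟨by simpa using h4, by simpa using h5⟩

/-- At a multiple zero `f''` would have order two less than `f`, while `-A f` has order at least
that of `f`. -/
theorem IsDiscSolution.deriv_ne_zero {A f : ℂ → ℂ} (hA : AnalyticOnNhd ℂ A (Metric.ball 0 1))
    (hf : IsDiscSolution A f) (hne : ∃ z ∈ Metric.ball (0 : ℂ) 1, f z ≠ 0) {z : ℂ}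
    (hz : z ∈ Metric.ball (0 : ℂ) 1) (h0 : f z = 0) : deriv f z ≠ 0 := by
  intro h1
  obtain ⟨hfa, hode⟩ := hf
  have hfz := hfa z hz
  have htop : analyticOrderAt f z ≠ ⊤ := by
    obtain ⟨x, hx, hfx⟩ := hne
    refine hfa.analyticOrderAt_ne_top_of_isPreconnected
      (convex_ball (0 : ℂ) 1).isPreconnected hx hz ?_
    rw [(hfa x hx).analyticOrderAt_eq_zero.2 hfx]
    simp
  have e1 := hfz.analyticOrderAt_deriv_add_one
  have e2 := hfz.deriv.analyticOrderAt_deriv_add_one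
  simp only [h0, h1, sub_zero] at e1 e2
  have e3 : analyticOrderAt (deriv (deriv f)) z = analyticOrderAt (-(A * f)) z := by
    apply analyticOrderAt_congr
    filter_upwards [Metric.isOpen_ball.mem_nhds hz] with x hx
    have := hode x hx
    simpa using eq_neg_of_add_eq_zero_left this
  rw [analyticOrderAt_neg, analyticOrderAt_mul (hA z hz) hfz] at e3
  have h4 : analyticOrderAt f z + 1 ≤ analyticOrderAt f z := by
    calc analyticOrderAt f z + 1
        ≤ analyticOrderAt A z + analyticOrderAt f z + 1 + 1 := by
          gcongr
          exact le_add_self.trans le_self_add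
      _ = analyticOrderAt f z := by rw [← e3, e2, e1]
  exact absurd h4 (not_le.2 (ENat.lt_add_one_iff htop |>.2 le_rfl))

/-! ### Lifting the equation to hyperbolic geodesics -/

theorem hasDerivAt_lift {A f : ℂ → ℂ} (hf : IsDiscSolution A f) {p p' q q' : ℝ → ℂ} {W : ℂ}
    (hp : ∀ t, HasDerivAt p (p' t) t) (hp' : ∀ t, HasDerivAt p' (p t) t)
    (hq : ∀ t, HasDerivAt q (q' t) t) (hW : ∀ t, q' t * p t - q t * p' t = W)
    (h0 : ∀ t, p t ≠ 0) (hb : ∀ t, q t / p t ∈ Metric.ball (0 : ℂ) 1) (t : ℝ) :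
    HasDerivAt (fun t => p t * f (q t / p t))
      (p' t * f (q t / p t) + W * deriv f (q t / p t) / p t) t ∧
    HasDerivAt (fun t => p' t * f (q t / p t) + W * deriv f (q t / p t) / p t)
      ((1 - W ^ 2 * A (q t / p t) / p t ^ 4) * (p t * f (q t / p t))) t := by
  have hz : HasDerivAt (fun t => q t / p t) (W / p t ^ 2) t := by
    rw [← hW t]; exact (hq t).div (hp t) (h0 t)
  have hfz := hf.1 _ (hb t)
  have d1 : HasDerivAt (fun t => f (q t / p t)) (deriv f (q t / p t) * (W / p t ^ 2)) t :=
    hfz.differentiableAt.hasDerivAt.comp t hz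
  have d2 : HasDerivAt (fun t => deriv f (q t / p t))
      (deriv (deriv f) (q t / p t) * (W / p t ^ 2)) t :=
    HasDerivAt.comp (h₂ := deriv f) t hfz.deriv.differentiableAt.hasDerivAt hz
  have hp0 := h0 t
  constructor
  · refine ((hp t).mul d1).congr_deriv ?_
    field_simp
  · refine (((hp' t).mul d1).add ((d2.const_mul W).div (hp t) hp0)).congr_deriv ?_
    rw [eq_neg_of_add_eq_zero_left (hf.2 _ (hb t))]
    field_simp
    ring

theorem exp_neg_abs_mul_norm_le {a b c : ℂ} {x : ℝ} (hb : ‖b‖ ≤ ‖a‖)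
    (hc : c = Real.cosh x * a + Real.sinh x * b) : Real.exp (-|x|) * ‖a‖ ≤ ‖c‖ := by
  have h1 : ‖(Real.cosh x : ℂ) * a‖ - ‖(Real.sinh x : ℂ) * b‖ ≤ ‖c‖ := by
    rw [hc]
    simpa using norm_sub_norm_le ((Real.cosh x : ℂ) * a) (-((Real.sinh x : ℂ) * b))
  rw [norm_mul, norm_mul, Complex.norm_real, Complex.norm_real, Real.norm_eq_abs,
    Real.norm_eq_abs, abs_of_pos (Real.cosh_pos x), Real.abs_sinh] at h1
  have h2 : Real.sinh |x| * ‖b‖ ≤ Real.sinh |x| * ‖a‖ :=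
    mul_le_mul_of_nonneg_left hb (Real.sinh_nonneg_iff.2 (abs_nonneg x))
  rw [← Real.cosh_sub_sinh, Real.cosh_abs]
  linarith

theorem two_le_of_geodesic {A f : ℂ → ℂ} {C : ℝ} (hC : 0 < C)
    (hA : AnalyticOnNhd ℂ A (Metric.ball 0 1))
    (hAC : ∀ z ∈ Metric.ball (0 : ℂ) 1, ‖A z‖ * (1 - ‖z‖ ^ 2) ^ 2 ≤ 1 + C * (1 - ‖z‖))
    (hf : IsDiscSolution A f) (hne : ∃ z ∈ Metric.ball (0 : ℂ) 1, f z ≠ 0)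
    {z₁ z₂ e : ℂ} {L H : ℝ} (hz₁ : ‖z₁‖ < 1) (he : ‖e‖ = 1) (hL : 0 < L)
    (hz₂ : z₂ * (Real.cosh L + star z₁ * e * Real.sinh L)
      = z₁ * Real.cosh L + e * Real.sinh L)
    (h₁ : f z₁ = 0) (h₂ : f z₂ = 0) (hH₁ : 1 - ‖z₁‖ ^ 2 ≤ H) (hH₂ : 1 - ‖z₂‖ ^ 2 ≤ H) :
    2 ≤ C * (Real.exp L * H) * L ^ 2 := by
  by_contra! hcon
  set p : ℝ → ℂ := fun t => Real.cosh t + star z₁ * e * Real.sinh t with hp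
  set p' : ℝ → ℂ := fun t => Real.sinh t + star z₁ * e * Real.cosh t with hp'
  set q : ℝ → ℂ := fun t => z₁ * Real.cosh t + e * Real.sinh t with hq
  set q' : ℝ → ℂ := fun t => z₁ * Real.sinh t + e * Real.cosh t with hq'
  set w : ℝ := 1 - ‖z₁‖ ^ 2 with hw
  have hwpos : 0 < w := by
    have := norm_nonneg z₁
    simp only [hw]; nlinarith
  have dc (t : ℝ) : HasDerivAt (fun t : ℝ => (Real.cosh t : ℂ)) (Real.sinh t) t :=
    (Real.hasDerivAt_cosh t).ofReal_comp
  have ds (t : ℝ) : HasDerivAt (fun t : ℝ => (Real.sinh t : ℂ)) (Real.cosh t) t :=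
    (Real.hasDerivAt_sinh t).ofReal_comp
  have cs (t : ℝ) : (Real.cosh t : ℂ) ^ 2 - (Real.sinh t : ℂ) ^ 2 = 1 := by
    exact_mod_cast Real.cosh_sq_sub_sinh_sq t
  have hzz : z₁ * star z₁ = (‖z₁‖ : ℂ) ^ 2 := by
    simpa using Complex.mul_conj' z₁
  have hee : e * star e = 1 := by
    have := Complex.mul_conj' e
    rw [he] at this
    simpa using this
  have nsq (a b : ℂ) (r : ℝ) (h : a * star a - b * star b = r) : ‖a‖ ^ 2 - ‖b‖ ^ 2 = r := by
    have ha : a * star a = (‖a‖ : ℂ) ^ 2 := by simpa using Complex.mul_conj' a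
    have hb : b * star b = (‖b‖ : ℂ) ^ 2 := by simpa using Complex.mul_conj' b
    rw [ha, hb] at h
    exact_mod_cast h
  have hwc : (w : ℂ) = 1 - z₁ * star z₁ := by rw [hzz]; simp [hw]
  have st (r : ℝ) : star (r : ℂ) = r := Complex.conj_ofReal r
  -- The geodesic stays in the disc, and `1 - |q/p|^2 = w / |p|^2`.
  have npq (t : ℝ) : ‖p t‖ ^ 2 - ‖q t‖ ^ 2 = w := by
    apply nsq
    simp only [hp, hq, star_add, star_mul', star_star, st, hwc]
    linear_combination (1 - z₁ * star z₁) * cs t +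
      (z₁ * star z₁ - 1) * (Real.sinh t : ℂ) ^ 2 * hee
  have npp (t : ℝ) : ‖p t‖ ^ 2 - ‖p' t‖ ^ 2 = w := by
    apply nsq
    simp only [hp, hp', star_add, star_mul', star_star, st, hwc]
    linear_combination (1 - z₁ * star z₁) * cs t +
      (z₁ * star z₁) * ((Real.sinh t : ℂ) ^ 2 - (Real.cosh t : ℂ) ^ 2) * hee
  have p0 (t : ℝ) : p t ≠ 0 := by
    intro h
    have := npq t
    rw [h, norm_zero] at this
    nlinarith [sq_nonneg ‖q t‖]
  have hpp (t : ℝ) : ‖p' t‖ ≤ ‖p t‖ := by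
    apply le_of_sq_le_sq _ (norm_nonneg _)
    linarith [npp t]
  have hone (t : ℝ) : 1 - ‖q t / p t‖ ^ 2 = w / ‖p t‖ ^ 2 := by
    have := norm_pos_iff.2 (p0 t)
    rw [← npq t, norm_div]
    field_simp
  have hball (t : ℝ) : q t / p t ∈ Metric.ball (0 : ℂ) 1 := by
    rw [mem_ball_zero_iff]
    have h1 := hone t
    have h2 : 0 < w / ‖p t‖ ^ 2 := div_pos hwpos (pow_pos (norm_pos_iff.2 (p0 t)) 2)
    nlinarith [norm_nonneg (q t / p t)]
  have hWr (t : ℝ) : q' t * p t - q t * p' t = e * w := by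
    simp only [hp, hp', hq, hq', hwc]
    linear_combination (e - e * (z₁ * star z₁)) * cs t
  -- Harnack-type control of height, from the addition formula expressing `p t` through `p s` and
  -- `p' s`.
  have harn (s t : ℝ) : 1 - ‖q t / p t‖ ^ 2 ≤ Real.exp (2 * |t - s|) * (1 - ‖q s / p s‖ ^ 2) := by
    have h1 : Real.exp (-|t - s|) * ‖p s‖ ≤ ‖p t‖ := by
      apply exp_neg_abs_mul_norm_le (hpp s)
      simp only [hp, hp', Real.cosh_sub, Real.sinh_sub]
      push_cast
      have := cs s
      push_cast at this
      linear_combination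
        -(Complex.cosh t + star z₁ * e * Complex.sinh t) * this
    have hs := norm_pos_iff.2 (p0 s)
    rw [hone, hone]
    have h2 : (Real.exp (-|t - s|) * ‖p s‖) ^ 2 ≤ ‖p t‖ ^ 2 := by gcongr
    calc w / ‖p t‖ ^ 2 ≤ w / (Real.exp (-|t - s|) * ‖p s‖) ^ 2 := by gcongr
      _ = _ := by
        rw [Real.exp_neg, two_mul, Real.exp_add]
        field_simp
  have hq0 : q 0 / p 0 = z₁ := by simp [hp, hq]
  have hqL : q L / p L = z₂ := by
    rw [div_eq_iff (p0 L)]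
    exact hz₂.symm
  have hH : 0 ≤ H := hwpos.le.trans hH₁
  -- The nearer endpoint is within `L / 2`, so the factor is `exp L` rather than `exp (2 * L)`.
  have hheight (t : ℝ) (ht : t ∈ Set.Icc 0 L) : 1 - ‖q t / p t‖ ^ 2 ≤ Real.exp L * H := by
    rcases le_total t (L / 2) with h | h
    · refine (harn 0 t).trans ?_
      rw [hq0, sub_zero, abs_of_nonneg ht.1]
      gcongr
      linarith
    · refine (harn L t).trans ?_
      have h2 : 0 ≤ 1 - ‖z₂‖ ^ 2 := by
        rw [← hqL, hone]
        positivity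
      rw [hqL, abs_of_nonpos (by linarith [ht.2])]
      gcongr
      linarith
  have hlift (t : ℝ) := hasDerivAt_lift hf (p := p) (p' := p') (q := q)
    (fun t => (dc t).add ((ds t).const_mul _)) (fun t => (ds t).add ((dc t).const_mul _))
    (fun t => ((dc t).const_mul _).add ((ds t).const_mul _)) hWr p0 hball t
  obtain ⟨hu, hu'⟩ := vanish_of_zeros_of_bound (B := fun t => (e * w) ^ 2 * A (q t / p t) / p t ^ 4)
    (ε := C * (Real.exp L * H)) hL hcon
    (fun t => (hlift t).1) (fun t => (hlift t).2)
    (by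
      intro t ht
      have h1 := hAC _ (hball t)
      have h2 := hheight t ht
      have h3 := hball t
      rw [mem_ball_zero_iff] at h3
      have h4 : ‖(e * w) ^ 2 * A (q t / p t) / p t ^ 4‖
          = ‖A (q t / p t)‖ * (1 - ‖q t / p t‖ ^ 2) ^ 2 := by
        rw [hone, norm_div, norm_mul, norm_pow, norm_pow, norm_mul, he, Complex.norm_real,
          Real.norm_of_nonneg hwpos.le]
        have := norm_pos_iff.2 (p0 t)
        field_simp
      rw [h4]
      refine h1.trans ?_
      gcongr
      nlinarith [norm_nonneg (q t / p t)])
    (by rw [hq0, h₁, mul_zero]) (by rw [hqL, h₂, mul_zero])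
  have hf0 : f (q (L / 2) / p (L / 2)) = 0 := (mul_eq_zero.1 hu).resolve_left (p0 _)
  rw [hf0, mul_zero, zero_add, div_eq_zero_iff, or_iff_left (p0 _), mul_eq_zero] at hu'
  refine hf.deriv_ne_zero hA hne (hball (L / 2)) hf0 (hu'.resolve_left ?_)
  apply mul_ne_zero
  · rw [← norm_ne_zero_iff, he]; exact one_ne_zero
  · exact_mod_cast hwpos.ne'

/-- The disc automorphism sending `z₁` to `0` sends `z₂` to `m`; then `e` is the direction of `m`
and `L = artanh ‖m‖`. -/
theorem exists_geodesic_direction {z₁ z₂ : ℂ} (hz₁ : ‖z₁‖ < 1) (hz₂ : ‖z₂‖ < 1) (hne : z₁ ≠ z₂) :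
    ∃ (e : ℂ) (L : ℝ), ‖e‖ = 1 ∧ 0 < L ∧
      z₂ * (Real.cosh L + star z₁ * e * Real.sinh L) = z₁ * Real.cosh L + e * Real.sinh L ∧
      Real.sinh L ^ 2 * ((1 - ‖z₁‖ ^ 2) * (1 - ‖z₂‖ ^ 2)) = ‖z₁ - z₂‖ ^ 2 := by
  have key : ‖1 - star z₁ * z₂‖ ^ 2 - ‖z₂ - z₁‖ ^ 2 = (1 - ‖z₁‖ ^ 2) * (1 - ‖z₂‖ ^ 2) := by
    simp only [Complex.sq_norm, Complex.normSq_apply, Complex.star_def]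
    simp
    ring
  have h1 : 0 < 1 - ‖z₁‖ ^ 2 := by nlinarith [norm_nonneg z₁]
  have h2 : 0 < 1 - ‖z₂‖ ^ 2 := by nlinarith [norm_nonneg z₂]
  have h12 := mul_pos h1 h2
  set d := 1 - star z₁ * z₂ with hd
  have hdpos : 0 < ‖d‖ := by
    rw [norm_pos_iff]
    intro h
    rw [h, norm_zero] at key
    nlinarith [sq_nonneg ‖z₂ - z₁‖]
  have hd0 : d ≠ 0 := norm_pos_iff.1 hdpos
  set m := (z₂ - z₁) / d with hm
  have hm0 : 0 < ‖m‖ := norm_pos_iff.2 (div_ne_zero (sub_ne_zero.2 hne.symm) hd0)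
  have hm1 : 1 - ‖m‖ ^ 2 = (1 - ‖z₁‖ ^ 2) * (1 - ‖z₂‖ ^ 2) / ‖d‖ ^ 2 := by
    rw [← key, hm, norm_div]
    field_simp
  have hmlt : ‖m‖ < 1 := by
    have : 0 < 1 - ‖m‖ ^ 2 := by rw [hm1]; positivity
    nlinarith
  have hmem : ‖m‖ ∈ Set.Ioo (-1 : ℝ) 1 := ⟨by linarith, hmlt⟩
  have hsinh : Real.sinh (Real.artanh ‖m‖) = ‖m‖ * Real.cosh (Real.artanh ‖m‖) := by
    rw [Real.sinh_artanh hmem, Real.cosh_artanh hmem, mul_one_div]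
  refine ⟨m / ‖m‖, Real.artanh ‖m‖, ?_, Real.artanh_pos ⟨hm0, hmlt⟩, ?_, ?_⟩
  · rw [norm_div, Complex.norm_real, norm_norm, div_self hm0.ne']
  · have hmc : (‖m‖ : ℂ) ≠ 0 := by exact_mod_cast hm0.ne'
    have hmd : m * d = z₂ - z₁ := div_mul_cancel₀ _ hd0
    rw [hsinh, Complex.ofReal_mul]
    field_simp
    clear_value m
    rw [hd] at hmd
    linear_combination -(Real.cosh (Real.artanh ‖m‖) : ℂ) * hmd
  · rw [Real.sinh_artanh hmem, div_pow, Real.sq_sqrt (by nlinarith), hm1, hm, norm_div,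
      norm_sub_rev z₁ z₂]
    field_simp

/-! ### Euclidean separation of zeros -/

theorem exp_le_one_add_two_sinh {L : ℝ} (hL : 0 ≤ L) : Real.exp L ≤ 1 + 2 * Real.sinh L := by
  have h0 : 0 ≤ Real.sinh L := Real.sinh_nonneg_iff.2 hL
  have : Real.cosh L ≤ 1 + Real.sinh L := by
    apply le_of_sq_le_sq _ (by positivity)
    nlinarith [Real.cosh_sq L]
  rw [← Real.cosh_add_sinh]
  linarith

/-- One extra factor of `sinh L` absorbs `L ^ 4`; `648 = 24 * 27` comes from `L ^ 4 / 24 ≤ exp L ≤ 3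
* sinh L` when `sinh L ≥ 1`. -/
theorem one_add_two_sinh_sq_mul_pow_le {L : ℝ} (hL : 0 ≤ L) :
    (1 + 2 * Real.sinh L) ^ 2 * L ^ 4 ≤ 648 * Real.sinh L ^ 3 := by
  have h1 : L ≤ Real.sinh L := Real.self_le_sinh_iff.2 hL
  have h0 : 0 ≤ Real.sinh L := hL.trans h1
  rcases le_total 1 (Real.sinh L) with h | h
  · have h2 : L ^ 4 / 24 ≤ Real.exp L := by
      simpa [Nat.factorial] using Real.pow_div_factorial_le_exp L hL 4
    have h3 := exp_le_one_add_two_sinh hL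
    calc (1 + 2 * Real.sinh L) ^ 2 * L ^ 4
        ≤ (1 + 2 * Real.sinh L) ^ 2 * (24 * (1 + 2 * Real.sinh L)) := by
          gcongr
          linarith
      _ = 24 * (1 + 2 * Real.sinh L) ^ 3 := by ring
      _ ≤ 24 * (3 * Real.sinh L) ^ 3 := by
          gcongr
          linarith
      _ = _ := by ring
  · calc (1 + 2 * Real.sinh L) ^ 2 * L ^ 4 ≤ 3 ^ 2 * Real.sinh L ^ 4 := by
          gcongr
          linarith
      _ = 9 * Real.sinh L ^ 3 * Real.sinh L := by ring
      _ ≤ 9 * Real.sinh L ^ 3 * 1 := by gcongr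
      _ ≤ _ := by nlinarith [pow_nonneg h0 3]

theorem le_cube_dist_of_zeros {A f : ℂ → ℂ} {C : ℝ} (hC : 0 < C)
    (hA : AnalyticOnNhd ℂ A (Metric.ball 0 1))
    (hAC : ∀ z ∈ Metric.ball (0 : ℂ) 1, ‖A z‖ * (1 - ‖z‖ ^ 2) ^ 2 ≤ 1 + C * (1 - ‖z‖))
    (hf : IsDiscSolution A f) (hne : ∃ z ∈ Metric.ball (0 : ℂ) 1, f z ≠ 0)
    {z₁ z₂ : ℂ} {h : ℝ} (hh : 0 < h) (h₁ : f z₁ = 0) (h₂ : f z₂ = 0) (h₁₂ : z₁ ≠ z₂)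
    (hz₁ : h / 2 < 1 - ‖z₁‖) (hz₁' : 1 - ‖z₁‖ ≤ h)
    (hz₂ : h / 2 < 1 - ‖z₂‖) (hz₂' : 1 - ‖z₂‖ ≤ h) :
    h ≤ 5184 * C ^ 2 * ‖z₁ - z₂‖ ^ 3 := by
  obtain ⟨e, L, he, hL, heq, hS⟩ := exists_geodesic_direction (z₁ := z₁) (z₂ := z₂)
    (by linarith) (by linarith) h₁₂
  have n1 := norm_nonneg z₁
  have n2 := norm_nonneg z₂
  have H := two_le_of_geodesic hC hA hAC hf hne (H := 2 * h) (by linarith) he hL heq h₁ h₂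
    (by nlinarith) (by nlinarith)
  have hS0 : 0 < Real.sinh L := Real.sinh_pos_iff.2 hL
  set S := Real.sinh L with hSdef
  have h3 : Real.exp L ≤ 1 + 2 * S := exp_le_one_add_two_sinh hL.le
  have hD : S * (h / 2) ≤ ‖z₁ - z₂‖ := by
    apply le_of_sq_le_sq _ (norm_nonneg _)
    rw [← hS, mul_pow, sq (h / 2)]
    gcongr <;> nlinarith
  have h4 : 1 ≤ C * h * (1 + 2 * S) * L ^ 2 := by
    have : C * h * L ^ 2 * Real.exp L ≤ C * h * L ^ 2 * (1 + 2 * S) := by gcongr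
    linarith
  -- Squaring produces `S ^ 3`, which pairs with `h ^ 3` once multiplied by `h`; `5184 = 8 * 648`.
  have h5 : 1 ≤ C ^ 2 * h ^ 2 * (648 * S ^ 3) := by
    calc (1 : ℝ) ≤ (C * h * (1 + 2 * S) * L ^ 2) ^ 2 := one_le_pow₀ h4
      _ = C ^ 2 * h ^ 2 * ((1 + 2 * S) ^ 2 * L ^ 4) := by ring
      _ ≤ _ := by
        exact mul_le_mul_of_nonneg_left (one_add_two_sinh_sq_mul_pow_le hL.le) (by positivity)
  calc h = h * 1 := (mul_one h).symm
    _ ≤ h * (C ^ 2 * h ^ 2 * (648 * S ^ 3)) := by gcongr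
    _ = 5184 * C ^ 2 * (S * (h / 2)) ^ 3 := by ring
    _ ≤ _ := by gcongr

/-! ### Counting zeros and summing over dyadic layers -/

theorem analyticOrderAt_eq_one_of_isDiscSolution {A f : ℂ → ℂ}
    (hA : AnalyticOnNhd ℂ A (Metric.ball 0 1)) (hf : IsDiscSolution A f)
    (hne : ∃ z ∈ Metric.ball (0 : ℂ) 1, f z ≠ 0) {z : ℂ}
    (hz : z ∈ Metric.ball (0 : ℂ) 1) (h0 : f z = 0) : analyticOrderAt f z = 1 :=
  (hf.1 z hz).analyticOrderAt_eq_one_of_zero_deriv_ne_zero h0 (hf.deriv_ne_zero hA hne hz h0)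

theorem norm_polar_sub_le {r r' θ θ' : ℝ} (h0 : 0 ≤ r') (h1 : r' ≤ 1) :
    ‖r * Complex.exp (θ * Complex.I) - r' * Complex.exp (θ' * Complex.I)‖
      ≤ |r - r'| + |θ - θ'| := by
  have e : r * Complex.exp (θ * Complex.I) - r' * Complex.exp (θ' * Complex.I)
      = ((r - r' : ℝ) : ℂ) * Complex.exp (θ * Complex.I)
        + r' * (Complex.exp (θ' * Complex.I) *
          (Complex.exp (Complex.I * ((θ - θ' : ℝ) : ℂ)) - 1)) := by
    rw [mul_sub, ← Complex.exp_add]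
    push_cast
    ring_nf
  rw [e]
  refine (norm_add_le _ _).trans ?_
  rw [norm_mul, norm_mul, norm_mul, Complex.norm_exp_ofReal_mul_I, Complex.norm_exp_ofReal_mul_I,
    Complex.norm_real, Complex.norm_real, Real.norm_of_nonneg h0, one_mul, mul_one,
    Real.norm_eq_abs]
  have h := Real.norm_exp_I_mul_ofReal_sub_one_le (x := θ - θ')
  rw [Real.norm_eq_abs] at h
  gcongr
  calc _ ≤ 1 * |θ - θ'| := by gcongr
    _ = _ := one_mul _

/-- Pigeonhole on a polar grid of mesh `δ / 2`: two points of one cell are less than `δ` apart. -/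
theorem encard_le_of_separated {Z : Set ℂ} {a w h δ : ℝ} (hδ : 0 < δ) (hh : h ≤ 1)
    (hw0 : 0 ≤ w) (hh0 : 0 ≤ h)
    (hZ : ∀ z ∈ Z, ∃ r θ : ℝ, z = r * Complex.exp (θ * Complex.I) ∧
      a ≤ θ ∧ θ ≤ a + w ∧ 1 - h ≤ r ∧ r ≤ 1)
    (hsep : ∀ z ∈ Z, ∀ z' ∈ Z, z ≠ z' → δ ≤ ‖z - z'‖) :
    (Z.encard : ℝ≥0∞) ≤ ENNReal.ofReal ((2 * w / δ + 1) * (2 * h / δ + 1)) := by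
  choose! r θ hz h1 h2 h3 h4 using hZ
  set N := ⌊2 * w / δ⌋₊
  set M := ⌊2 * h / δ⌋₊
  set g : ℂ → ℕ × ℕ := fun z => (⌊2 * (θ z - a) / δ⌋₊, ⌊2 * (r z - (1 - h)) / δ⌋₊) with hg
  have hmaps : Set.MapsTo g Z (Finset.range (N + 1) ×ˢ Finset.range (M + 1) : Finset (ℕ × ℕ)) := by
    intro z hzZ
    rw [Finset.mem_coe, Finset.mem_product, Finset.mem_range, Finset.mem_range,
      Nat.lt_succ_iff, Nat.lt_succ_iff]
    have := h2 z hzZ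
    have := h4 z hzZ
    constructor
    · apply Nat.floor_le_floor
      gcongr
      linarith
    · apply Nat.floor_le_floor
      gcongr
      linarith
  have hfl {s t : ℝ} (hs : 0 ≤ s) (ht : 0 ≤ t) (hst : ⌊2 * s / δ⌋₊ = ⌊2 * t / δ⌋₊) :
      |s - t| < δ / 2 := by
    have a1 := Nat.floor_le (show 0 ≤ 2 * s / δ by positivity)
    have a2 := Nat.lt_floor_add_one (2 * s / δ)
    have b1 := Nat.floor_le (show 0 ≤ 2 * t / δ by positivity)
    have b2 := Nat.lt_floor_add_one (2 * t / δ)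
    rw [hst] at a1 a2
    have c1 : 2 * s / δ < 2 * t / δ + 1 := by linarith
    have c2 : 2 * t / δ < 2 * s / δ + 1 := by linarith
    rw [div_add_one hδ.ne', div_lt_div_iff_of_pos_right hδ] at c1 c2
    rw [abs_lt]
    constructor <;> linarith
  have hinj : Set.InjOn g Z := by
    intro z hzZ z' hzZ' hgg
    by_contra hne
    have hs := hsep z hzZ z' hzZ' hne
    rw [hg, Prod.mk.injEq] at hgg
    have d1 := hfl (by linarith [h1 z hzZ]) (by linarith [h1 z' hzZ']) hgg.1
    have d2 := hfl (by linarith [h3 z hzZ]) (by linarith [h3 z' hzZ']) hgg.2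
    rw [sub_sub_sub_cancel_right] at d1 d2
    have := norm_polar_sub_le (r := r z) (r' := r z') (θ := θ z) (θ' := θ z')
      (by linarith [h3 z' hzZ']) (h4 z' hzZ')
    rw [← hz z hzZ, ← hz z' hzZ'] at this
    linarith
  have hcard := Set.encard_le_encard_of_injOn hmaps hinj
  rw [Set.encard_coe_eq_coe_finsetCard, Finset.card_product, Finset.card_range,
    Finset.card_range] at hcard
  calc (Z.encard : ℝ≥0∞) ≤ ((((N + 1) * (M + 1) : ℕ) : ℕ∞) : ℝ≥0∞) := by exact_mod_cast hcard
    _ = ENNReal.ofReal (((N + 1) * (M + 1) : ℕ) : ℝ) := by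
      rw [ENNReal.ofReal_natCast, ENat.toENNReal_coe]
    _ ≤ _ := by
      apply ENNReal.ofReal_le_ofReal
      push_cast
      gcongr
      · exact Nat.floor_le (by positivity)
      · exact Nat.floor_le (by positivity)

theorem exists_polar_of_mem_carlesonSquare {I : Set ℂ} {l : ℝ} (hI : IsCircleArc I l) :
    0 < l ∧ l ≤ 1 ∧ ∃ a : ℝ, ∀ z ∈ carlesonSquare I l, ‖z‖ < 1 ∧ 1 - ‖z‖ ≤ l ∧
      ∃ θ : ℝ, z = ‖z‖ * Complex.exp (θ * Complex.I) ∧ a ≤ θ ∧ θ ≤ a + 2 * Real.pi * l := by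
  obtain ⟨a, b, J, hab, hb, -, hJ, rfl, rfl⟩ := hI
  have hpi := Real.pi_pos
  have hl1 : (b - a) / (2 * Real.pi) ≤ 1 := by
    rw [div_le_one (by positivity)]
    linarith
  refine ⟨div_pos (by linarith) (by positivity), hl1, a, ?_⟩
  rintro z ⟨r, -, ⟨θ, hθ, rfl⟩, hr, hr1, rfl⟩
  have hn : ‖(r : ℂ) * Complex.exp (θ * Complex.I)‖ = r := by
    rw [norm_mul, Complex.norm_exp_ofReal_mul_I, mul_one, Complex.norm_real,
      Real.norm_of_nonneg (by linarith)]
  simp only [hn]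
  refine ⟨hr1, by linarith, θ, rfl, (hJ hθ).1, ?_⟩
  rw [mul_div_cancel₀ _ (by positivity)]
  linarith [(hJ hθ).2]

/-- With height `x ^ 6`, the separation `κ * x ^ 2` and the weight `x ^ 3` are both integer powers.
The bound is linear in `x`, hence summable over dyadic layers. -/
theorem tsum_level_le {A f : ℂ → ℂ} {C κ : ℝ} (hC : 0 < C)
    (hA : AnalyticOnNhd ℂ A (Metric.ball 0 1))
    (hAC : ∀ z ∈ Metric.ball (0 : ℂ) 1, ‖A z‖ * (1 - ‖z‖ ^ 2) ^ 2 ≤ 1 + C * (1 - ‖z‖))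
    (hf : IsDiscSolution A f) (hne : ∃ z ∈ Metric.ball (0 : ℂ) 1, f z ≠ 0)
    (hκ : 0 < κ) (hκC : κ ^ 3 * (5184 * C ^ 2) = 1) {I : Set ℂ} {x y : ℝ}
    (hI : IsCircleArc I (y ^ 6)) (hx : 0 < x) (hxy : x ≤ y) :
    ∑' z : {z : ℂ | (z ∈ carlesonSquare I (y ^ 6) ∧ f z = 0) ∧
        x ^ 6 / 2 < 1 - ‖z‖ ∧ 1 - ‖z‖ ≤ x ^ 6},
      ((analyticOrderAt f (z : ℂ) : ℕ∞) : ℝ≥0∞) *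
        ENNReal.ofReal ((1 - ‖(z : ℂ)‖) ^ (1 / 2 : ℝ))
      ≤ ENNReal.ofReal ((2 / κ + 1) * (4 * Real.pi / κ + 1) * (y ^ 2 * x)) := by
  set Z := {z : ℂ | (z ∈ carlesonSquare I (y ^ 6) ∧ f z = 0) ∧
        x ^ 6 / 2 < 1 - ‖z‖ ∧ 1 - ‖z‖ ≤ x ^ 6} with hZdef
  obtain ⟨hl0, hl1, a, hpol⟩ := exists_polar_of_mem_carlesonSquare hI
  have hy : 0 < y := hx.trans_le hxy
  have hy1 : y ≤ 1 := (pow_le_one_iff_of_nonneg hy.le (by norm_num)).1 hl1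
  have hx1 : x ≤ 1 := hxy.trans hy1
  have hpi := Real.pi_pos
  have hcard : (Z.encard : ℝ≥0∞) ≤ ENNReal.ofReal
      ((2 * (2 * Real.pi * y ^ 6) / (κ * x ^ 2) + 1) * (2 * x ^ 6 / (κ * x ^ 2) + 1)) := by
    refine encard_le_of_separated (a := a) (by positivity) (pow_le_one₀ hx.le hx1)
      (by positivity) (by positivity) ?_ ?_
    · rintro z ⟨⟨hz, -⟩, -, hz2⟩
      obtain ⟨b1, b2, θ, b3, b4, b5⟩ := hpol z hz
      exact ⟨‖z‖, θ, b3, b4, b5, by linarith, b1.le⟩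
    · rintro z ⟨⟨-, hz0⟩, hz1, hz2⟩ z' ⟨⟨-, hz0'⟩, hz1', hz2'⟩ hzz
      have := le_cube_dist_of_zeros hC hA hAC hf hne (by positivity) hz0 hz0' hzz hz1 hz2 hz1' hz2'
      refine le_of_pow_le_pow_left₀ (n := 3) (by norm_num) (norm_nonneg _) ?_
      calc (κ * x ^ 2) ^ 3 = κ ^ 3 * x ^ 6 := by ring
        _ ≤ κ ^ 3 * (5184 * C ^ 2 * ‖z - z'‖ ^ 3) := by gcongr
        _ = ‖z - z'‖ ^ 3 := by rw [← mul_assoc, hκC, one_mul]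
  calc _ ≤ ∑' _ : Z, ENNReal.ofReal (x ^ 3) := by
        refine ENNReal.tsum_le_tsum ?_
        rintro ⟨z, ⟨hz, hz0⟩, -, hz2⟩
        have hb := (hpol z hz).1
        rw [analyticOrderAt_eq_one_of_isDiscSolution hA hf hne (mem_ball_zero_iff.2 hb) hz0]
        simp only [ENat.toENNReal_one, one_mul]
        apply ENNReal.ofReal_le_ofReal
        rw [← Real.sqrt_eq_rpow]
        apply Real.sqrt_le_iff.2
        exact ⟨by positivity, by rw [← pow_mul]; exact hz2⟩
    _ = Z.encard * ENNReal.ofReal (x ^ 3) := ENNReal.tsum_set_const _ _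
    _ ≤ ENNReal.ofReal
      ((2 * (2 * Real.pi * y ^ 6) / (κ * x ^ 2) + 1) * (2 * x ^ 6 / (κ * x ^ 2) + 1))
        * ENNReal.ofReal (x ^ 3) := by gcongr
    _ = ENNReal.ofReal ((2 / κ * x ^ 4 + 1) * (4 * Real.pi / κ * (y ^ 6 * x) + x ^ 3)) := by
      rw [← ENNReal.ofReal_mul (by positivity)]
      congr 1
      field_simp
      ring
    _ ≤ _ := by
      apply ENNReal.ofReal_le_ofReal
      have k1 : x ^ 4 ≤ 1 := pow_le_one₀ hx.le hx1
      have k2 : y ^ 6 * x ≤ y ^ 2 * x := by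
        gcongr ?_ * _
        exact pow_le_pow_of_le_one hy.le hy1 (by norm_num)
      have k3 : x ^ 3 ≤ y ^ 2 * x := by
        rw [pow_succ]
        gcongr
      calc _ ≤ (2 / κ * 1 + 1) * (4 * Real.pi / κ * (y ^ 2 * x) + y ^ 2 * x) := by gcongr
        _ = _ := by ring

theorem mainTheorem4 (C : ℝ) (hC : 0 < C) :
    ∃ K : ℝ, 0 < K ∧
      ∀ A : ℂ → ℂ, AnalyticOnNhd ℂ A (Metric.ball 0 1) →
        (∀ z ∈ Metric.ball (0 : ℂ) 1,
          ‖A z‖ * (1 - ‖z‖ ^ 2) ^ 2 ≤ 1 + C * (1 - ‖z‖)) →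
        ∀ f : ℂ → ℂ, IsDiscSolution A f → (∃ z ∈ Metric.ball (0 : ℂ) 1, f z ≠ 0) →
          ∀ (I : Set ℂ) (l : ℝ), IsCircleArc I l →
            zeroSum f (carlesonSquare I l) ≤ ENNReal.ofReal (K * l ^ (1 / 2 : ℝ)) := by
  have root (c : ℝ) (hc : 0 < c) (n : ℕ) (hn : n ≠ 0) : ∃ x : ℝ, 0 < x ∧ x ^ n = c :=
    ⟨c ^ (n⁻¹ : ℝ), Real.rpow_pos_of_pos hc _, Real.rpow_inv_natCast_pow hc.le hn⟩
  obtain ⟨κ, hκ, hκC⟩ := root (1 / (5184 * C ^ 2)) (by positivity) 3 (by norm_num)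
  -- Halving the height `x ^ 6` multiplies `x` by `ρ`.
  obtain ⟨ρ, hρ, hρ6⟩ := root (1 / 2) (by norm_num) 6 (by norm_num)
  have hρ1 : ρ < 1 := (pow_lt_one_iff_of_nonneg hρ.le (n := 6) (by norm_num)).1
    (by rw [hρ6]; norm_num)
  have hpi := Real.pi_pos
  set K₀ := (2 / κ + 1) * (4 * Real.pi / κ + 1) with hK₀
  have hK₀pos : 0 < K₀ := by positivity
  have hρ' : 0 < (1 - ρ)⁻¹ := inv_pos.2 (by linarith)
  refine ⟨K₀ * (1 - ρ)⁻¹, by positivity, ?_⟩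
  intro A hA hAC f hf hne I l hI
  obtain ⟨hl0, hl1, a, hpol⟩ := exists_polar_of_mem_carlesonSquare hI
  obtain ⟨y, hy, rfl⟩ := root l hl0 6 (by norm_num)
  set Z : ℕ → Set ℂ := fun n => {z : ℂ | (z ∈ carlesonSquare I (y ^ 6) ∧ f z = 0) ∧
        (y * ρ ^ n) ^ 6 / 2 < 1 - ‖z‖ ∧ 1 - ‖z‖ ≤ (y * ρ ^ n) ^ 6} with hZ
  have hcover : {z : ℂ | z ∈ carlesonSquare I (y ^ 6) ∧ f z = 0} ⊆ ⋃ n, Z n := by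
    rintro z ⟨hz, hz0⟩
    obtain ⟨b1, b2, -⟩ := hpol z hz
    obtain ⟨n, hn1, hn2⟩ := exists_nat_pow_near_of_lt_one (x := (1 - ‖z‖) / y ^ 6)
      (y := (1 / 2 : ℝ)) (div_pos (by linarith) hl0) ((div_le_one hl0).2 b2) (by norm_num)
      (by norm_num)
    have hpow : (y * ρ ^ n) ^ 6 = (1 / 2) ^ n * y ^ 6 := by
      rw [← hρ6]; ring
    rw [lt_div_iff₀ hl0] at hn1
    rw [div_le_iff₀ hl0] at hn2
    refine Set.mem_iUnion.2 ⟨n, ⟨hz, hz0⟩, ?_, ?_⟩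
    · rw [hpow]
      refine lt_of_eq_of_lt ?_ hn1
      ring
    · rw [hpow]; exact hn2
  have hsum : HasSum (fun n : ℕ => K₀ * (y ^ 2 * (y * ρ ^ n))) (K₀ * (1 - ρ)⁻¹ * y ^ 3) := by
    have h := (hasSum_geometric_of_lt_one hρ.le hρ1).mul_left (K₀ * y ^ 3)
    rw [mul_right_comm K₀]
    rwa [show (fun n : ℕ => K₀ * (y ^ 2 * (y * ρ ^ n))) = fun n => K₀ * y ^ 3 * ρ ^ n from
      funext fun n => by ring]
  calc zeroSum f (carlesonSquare I (y ^ 6))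
      ≤ ∑' z : ⋃ n, Z n, ((analyticOrderAt f (z : ℂ) : ℕ∞) : ℝ≥0∞) *
        ENNReal.ofReal ((1 - ‖(z : ℂ)‖) ^ (1 / 2 : ℝ)) :=
        ENNReal.tsum_mono_subtype (fun z : ℂ => ((analyticOrderAt f z : ℕ∞) : ℝ≥0∞) *
          ENNReal.ofReal ((1 - ‖z‖) ^ (1 / 2 : ℝ))) hcover
    _ ≤ ∑' n, ∑' z : Z n, ((analyticOrderAt f (z : ℂ) : ℕ∞) : ℝ≥0∞) *
        ENNReal.ofReal ((1 - ‖(z : ℂ)‖) ^ (1 / 2 : ℝ)) :=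
        ENNReal.tsum_iUnion_le_tsum (fun z : ℂ => ((analyticOrderAt f z : ℕ∞) : ℝ≥0∞) *
          ENNReal.ofReal ((1 - ‖z‖) ^ (1 / 2 : ℝ))) Z
    _ ≤ ∑' n : ℕ, ENNReal.ofReal (K₀ * (y ^ 2 * (y * ρ ^ n))) := by
        refine ENNReal.tsum_le_tsum fun n => ?_
        refine tsum_level_le hC hA hAC hf hne hκ ?_ hI (by positivity)
          (mul_le_of_le_one_right hy.le (pow_le_one₀ hρ.le hρ1.le))
        rw [hκC]
        field_simp
    _ = ENNReal.ofReal (K₀ * (1 - ρ)⁻¹ * y ^ 3) := by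
        rw [← ENNReal.ofReal_tsum_of_nonneg (fun n => by positivity) hsum.summable, hsum.tsum_eq]
    _ = _ := by
        rw [← Real.sqrt_eq_rpow, show y ^ 6 = (y ^ 3) ^ 2 by ring, Real.sqrt_sq (by positivity)]
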